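/- **Conventions.** Let $\mathcal D=(D,<,\rho)$ be a computable partially ordered set: $<$ is a partial order on $D$, $\rho:\mathbb N\to D$ is a bijection, and $\{(m,n):\rho(m)<\rho(n)\}$ is computable. A partial function $F$ into $D$ is partial computable (resp. partial computable in the halting problem $\emptyset'$) if $\rho^{-1}\circ F$ is. Let ${\bf 2}^*$ be the set of binary words and consider the following classes of partial functions ${\bf 2}^*\to D$: - $PR$, the partial computable functions, and $PR^{\emptyset'}$, the functions partial computable in $\emptyset'$; - $Max_{PR}$ (resp. $Min_{PR}$), the functions $F$ for which there is a partial computable $f:{\bf 2}^*\times\mathbb N\to D$, monotone increasing (resp. decreasing) in its second argument on its domain, such that $F(p)$ is defined if and only if $\{f(p,t):t\in\mathbb N,\ f(p,t)\text{ defined}\}$ is finite and nonempty, and $F(p)$ is then the greatest (resp. least) element of this set. For a partial function $\varphi:{\bf 2}^*\to D$ and $d$ in its range let $K_\varphi(d)=\min\{|p|:\varphi(p)=d\}$. A function $\varphi$ in a class $C$ is optimal in $C$ if for every $\psi\in C$ there is a constant $c$ such that every $d$ in the range of $\psi$ is in the range of $\varphi$ and satisfies $K_\varphi(d)\le K_\psi(d)+c$.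 (For the four classes above an optimal function has range $D$, so that $K_\varphi$ is total.) Let $K^D$, $K^{\emptyset',D}$, $K_{\max}^{\mathcal D}$, $K_{\min}^{\mathcal D}$ be the functions $K_\varphi$ for arbitrarily chosen optimal functions $\varphi$ in $PR$, $PR^{\emptyset'}$, $Max_{PR}$, $Min_{PR}$ respectively. Write $f\le_{ct}g$ if there is a constant $c$ with $f(d)\le g(d)+c$ for all $d\in D$, and $f<_{ct}g$ if $f\le_{ct}g$ and not $g\le_{ct}f$. Let $\log$ be the logarithm to base $2$, with $\log 0=0$. **Theorem.** For every computable partially ordered set $\mathcal D$ and every choice of the optimal functions: 1. $K^{\emptyset',D}<_{ct}\inf(K_{\max}^{\mathcal D},K_{\min}^{\mathcal D})$. 2. $K_{\max}^{\mathcal D}\le_{ct}K^D$ and $K_{\min}^{\mathcal D}\le_{ct}K^D$, and $$K^D\le_{ct}\bigl(K_{\max}^{\mathcal D}+\log K_{\max}^{\mathcal D}\bigr)+\bigl(K_{\min}^{\mathcal D}+\log K_{\min}^{\mathcal D}\bigr).$$ 3. More generally, let $c:{\bf 2}^*\times{\bf 2}^*\to{\bf 2}^*$ be a total computable injective map, and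 let $J:\mathbb N\times\mathbb N\to\mathbb N$ and $M\in\mathbb N$ be such that $|c(p,q)|\le J(|p|,|q|)+M$ for all $p,q\in{\bf 2}^*$. Then $K^D\le_{ct}J(K_{\min}^{\mathcal D},K_{\max}^{\mathcal D})$. -/

import Mathlib

namespace KolmogorovPoset

/-- `f` is at most `g` up to an additive constant. -/
def LeCt {S R : Type*} [Add R] [LE R] (f g : S → R) : Prop :=
  ∃ c : R, ∀ s, f s ≤ g s + c

/-- `f` is strictly below `g` up to an additive constant. -/
def LtCt {S R : Type*} [Add R] [LE R] (f g : S → R) : Prop :=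
  LeCt f g ∧ ¬ LeCt g f

variable {D : Type*}

/-- With the numbering `ρ : ℕ ≃ D`, the strict order of `D` is decidable, i.e.
`(D, <, ρ)` is a computable partially ordered set. -/
def IsComputablePoset [PartialOrder D] (ρ : ℕ ≃ D) : Prop :=
  ComputablePred fun mn : ℕ × ℕ => ρ mn.1 < ρ mn.2

/-- A partial function into `D` is partial computable if its composition with `ρ⁻¹` is. -/
def PartrecInto {X : Type*} [Primcodable X] (ρ : ℕ ≃ D) (F : X →. D) : Prop :=
  Partrec fun x => (F x).map ρ.symm

/-- The characteristic function of the halting set `∅'`, the set of all `n` such that the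
`n`-th partial computable function is defined at `n`. -/
noncomputable def haltingOracle : ℕ →. ℕ :=
  open Classical in
  fun n => Part.some
    (if ((Denumerable.ofNat Nat.Partrec.Code n).eval n).Dom then 1 else 0)

/-- Partial functions into `D` which are partial computable with oracle `∅'`. -/
def JumpPartrecInto {X : Type*} [Primcodable X] (ρ : ℕ ≃ D) (F : X →. D) : Prop :=
  RecursiveIn {haltingOracle} fun x => (F x).map ρ.symm

/-- The set of values `f(x,t)`, `t ∈ ℕ`, over those `t` at which it is defined. -/
def valuesAt {X : Type*} (f : X × ℕ →. D) (x : X) : Set D :=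
  {d | ∃ t, d ∈ f (x, t)}

/-- `F = max f`: `f` is monotone increasing in its second argument on its domain, `F` is defined
at those `x` for which `t ↦ f(x,t)` has finite nonempty range, and `F(x)` is the greatest
element of this range. -/
def IsMaxOf {X : Type*} [PartialOrder D] (f : X × ℕ →. D) (F : X →. D) : Prop :=
  (∀ x s t a b, s ≤ t → a ∈ f (x, s) → b ∈ f (x, t) → a ≤ b) ∧
  (∀ x, (F x).Dom ↔ (valuesAt f x).Finite ∧ (valuesAt f x).Nonempty) ∧
  (∀ x, ∀ d ∈ F x, IsGreatest (valuesAt f x) d)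

/-- `F = min f`: the same with `f` monotone decreasing and least elements. -/
def IsMinOf {X : Type*} [PartialOrder D] (f : X × ℕ →. D) (F : X →. D) : Prop :=
  (∀ x s t a b, s ≤ t → a ∈ f (x, s) → b ∈ f (x, t) → b ≤ a) ∧
  (∀ x, (F x).Dom ↔ (valuesAt f x).Finite ∧ (valuesAt f x).Nonempty) ∧
  (∀ x, ∀ d ∈ F x, IsLeast (valuesAt f x) d)

/-- The class of partial computable functions from binary words to `D`. -/
def classPR (ρ : ℕ ≃ D) : Set (List Bool →. D) :=
  {F | PartrecInto ρ F}

/-- The class of functions from binary words to `D` that are partial computable in `∅'`. -/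
def classJumpPR (ρ : ℕ ≃ D) : Set (List Bool →. D) :=
  {F | JumpPartrecInto ρ F}

/-- The class of maxima of partial computable `f`, increasing in the second argument. -/
def classMaxPR [PartialOrder D] (ρ : ℕ ≃ D) : Set (List Bool →. D) :=
  {F | ∃ f : List Bool × ℕ →. D, PartrecInto ρ f ∧ IsMaxOf f F}

/-- The class of minima of partial computable `f`, decreasing in the second argument. -/
def classMinPR [PartialOrder D] (ρ : ℕ ≃ D) : Set (List Bool →. D) :=
  {F | ∃ f : List Bool × ℕ →. D, PartrecInto ρ f ∧ IsMinOf f F}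

/-- `K_φ(d)`, the least length of a program `p` with `φ(p) = d`. It is meaningful for `d` in the
range of `φ` only (outside it takes the default value `0`). -/
noncomputable def complexity (φ : List Bool →. D) (d : D) : ℕ :=
  sInf {n | ∃ p, d ∈ φ p ∧ p.length = n}

/-- `φ` is optimal in the class `C`: it belongs to `C`, and for each `ψ ∈ C` one has
`K_φ ≤ K_ψ` up to a constant, as partial functions: where `K_ψ` is defined, so is `K_φ`. -/
def IsOptimal (C : Set (List Bool →. D)) (φ : List Bool →. D) : Prop :=
  φ ∈ C ∧ ∀ ψ ∈ C, ∃ c : ℕ, ∀ d ∈ ψ.ran,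
    d ∈ φ.ran ∧ complexity φ d ≤ complexity ψ d + c

end KolmogorovPoset

open KolmogorovPoset

open KolmogorovPoset

namespace KolmogorovPoset
open Nat.Partrec (Code)
open Encodable Filter

/-! ### Limits of computable functions are computable in the halting problem -/

/-! Everything rests on `IsApproximation`. A function in the max class is the limit of a computable
sequence that increases along the order, so it never returns to a value it has left and stays below
the limit; dually for the min class (`exists_isApproximation_of_isMaxOf`, applied to the order dual
for minima).

Such limits are computable in the halting problem, which gives the inequality in (1). For
strictness, the oracle computes from `p` an element that is no value of `U` or `V` on words of
length at most `2 * p.length` (`exists_mem_classJumpPR_avoiding`): its jump complexity is at most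
about `p.length`, while the other two exceed twice that.

For (3), let `d` be the maximum described by `q` and the minimum described by `p`. The
approximations from below and from above squeeze `d`, so wherever they agree they equal `d`, and
they do agree eventually. Hence `d` is computable from a code of `(p, q)`
(`exists_mem_classPR_of_pairing`). The logarithmic bound in (2) is the case of the pairing
`wordPair`; the other bounds in (2) hold because a computable function is its own maximum and
minimum. -/

/-- The domain of a partial recursive function is decidable in the halting problem. -/
theorem exists_recursiveIn_haltingOracle {B : ℕ →. ℕ} (hB : Nat.Partrec B) :
    ∃ b : ℕ → ℕ, (Nat.RecursiveIn {haltingOracle} fun n => Part.some (b n)) ∧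
      ∀ n, b n = 0 ↔ ¬ (B n).Dom := by
  classical
  -- The program `Code.curry c n` ignores its input and simulates `B n`, so it halts on its own
  -- index exactly when `B n` is defined.
  have hB' : Nat.Partrec fun n => B n.unpair.1 :=
    (Nat.Partrec.comp hB Nat.Partrec.left).of_eq fun n => Part.bind_some _ _
  obtain ⟨c, hc⟩ := Code.exists_code.1 hB'
  have hj : Nat.Primrec fun n => encode (Code.curry c n) :=
    Primrec.nat_iff.1
      (Primrec.encode.comp (Code.primrec₂_curry.comp (Primrec.const c) Primrec.id))
  refine ⟨fun n => if (B n).Dom then 1 else 0,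
    (Nat.RecursiveIn.comp (.oracle _ (Set.mem_singleton _)) hj.recursiveIn).of_eq fun n => ?_,
    fun n => by simp⟩
  have key : (Denumerable.ofNat Code (encode (Code.curry c n))).eval
      (encode (Code.curry c n)) = B n := by
    rw [Denumerable.ofNat_encode, Code.eval_curry, hc]; simp
  refine (Part.bind_some (encode (Code.curry c n)) haltingOracle).trans (congrArg Part.some ?_)
  exact if_congr (iff_of_eq (congrArg Part.Dom key)) rfl rfl

/-- That a stage is not yet stable is a computably enumerable fact, which the oracle decides.
Searching for the first stable stage and reading `g` there gives the limit; without a limit the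
search diverges. -/
theorem nat_recursiveIn_of_eventually {g : ℕ → ℕ → Option ℕ} (hg : Computable₂ g) {h : ℕ →. ℕ}
    (hh : ∀ n m, m ∈ h n ↔ ∀ᶠ s in atTop, g n s = some m) :
    Nat.RecursiveIn {haltingOracle} h := by
  classical
  -- With `a` coding `(n, t)`, a true value witnesses that `t` is not a stable stage for `n`.
  let P : ℕ → ℕ → Bool := fun a s =>
    decide (g a.unpair.1 a.unpair.2 = none) ||
      !decide (g a.unpair.1 (a.unpair.2 + s) = g a.unpair.1 a.unpair.2)
  have hu1 : Computable fun x : ℕ × ℕ => x.1.unpair.1 :=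
    Computable.fst.comp (Computable.unpair.comp Computable.fst)
  have hu2 : Computable fun x : ℕ × ℕ => x.1.unpair.2 :=
    Computable.snd.comp (Computable.unpair.comp Computable.fst)
  have hg1 : Computable fun x : ℕ × ℕ => g x.1.unpair.1 x.1.unpair.2 := hg.comp hu1 hu2
  have hg2 : Computable fun x : ℕ × ℕ => g x.1.unpair.1 (x.1.unpair.2 + x.2) :=
    hg.comp hu1 (Primrec.nat_add.to_comp.comp hu2 Computable.snd)
  have heq : Computable₂ fun a b : Option ℕ => decide (a = b) :=
    (PrimrecRel.decide Primrec.eq).to_comp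
  have hP : Computable₂ P :=
    Primrec.or.to_comp.comp (heq.comp hg1 (Computable.const none))
      (Primrec.not.to_comp.comp (heq.comp hg2 hg1))
  have hB : Nat.Partrec fun a => Nat.rfind fun s => Part.some (P a s) :=
    Partrec.nat_iff.1 (Partrec.rfind hP.partrec₂)
  have hdom : ∀ a, (Nat.rfind fun s => Part.some (P a s)).Dom ↔ ∃ s, P a s = true := by
    exact fun a => Nat.rfind_dom'.trans (exists_congr fun s =>
      ⟨fun h => (Part.mem_some_iff.1 h.1).symm, fun h => ⟨h ▸ Part.mem_some _, fun _ => trivial⟩⟩)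
  obtain ⟨b, hb, hbB⟩ := exists_recursiveIn_haltingOracle hB
  -- A zero of `b` is a stage without such a witness.
  have hR := Nat.RecursiveIn.rfind hb
  have hid : Nat.RecursiveIn {haltingOracle} fun n => Part.some n :=
    (Partrec.nat_iff.1 Partrec.some).recursiveIn
  have hG : Nat.RecursiveIn {haltingOracle}
      fun a => (g a.unpair.1 a.unpair.2 : Part ℕ) :=
    (Partrec.nat_iff.1 (Computable.ofOption (hg.comp
      (Computable.fst.comp Computable.unpair) (Computable.snd.comp Computable.unpair)))).recursiveIn
  refine (Nat.RecursiveIn.comp hG (.pair hid hR)).of_eq fun n => ?_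
  have hval : ∀ t, (fun m => decide (m = 0)) <$> Part.some (b (Nat.pair n t)) =
      Part.some (decide (∀ s, P (Nat.pair n t) s = false)) := by
    intro t
    rw [Part.map_eq_map, Part.map_some]
    congr 2
    rw [hbB, hdom]
    simp
  have hstable : ∀ t, (∀ s, P (Nat.pair n t) s = false) ↔
      ∃ m, g n t = some m ∧ ∀ s ≥ t, g n s = some m := by
    intro t
    simp only [P, Nat.unpair_pair, Bool.or_eq_false_iff, decide_eq_false_iff_not,
      Bool.not_eq_false', decide_eq_true_eq]
    constructor
    · intro hs
      obtain ⟨m, hm⟩ := Option.ne_none_iff_exists'.1 (hs 0).1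
      refine ⟨m, hm, fun s hst => ?_⟩
      obtain ⟨k, rfl⟩ := Nat.exists_eq_add_of_le hst
      rw [(hs k).2, hm]
    · rintro ⟨m, hm, hs⟩ k
      exact ⟨by simp [hm], by rw [hs _ (Nat.le_add_right t k), hm]⟩
  simp only [hval]
  ext m
  simp only [Part.bind_eq_bind, Part.mem_bind_iff, Seq.seq, Part.map_eq_map, Part.mem_map_iff,
    Part.mem_some_iff, Part.mem_ofOption, hh, eventually_atTop]
  constructor
  · rintro ⟨a, ⟨_, ⟨_, rfl, rfl⟩, t, ht, rfl⟩, hm⟩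
    have h1 := Nat.rfind_spec ht
    rw [Part.mem_some_iff, eq_comm, decide_eq_true_eq, hstable] at h1
    obtain ⟨m', h1, h2⟩ := h1
    simp only [Nat.unpair_pair] at hm
    rw [h1] at hm
    cases hm
    exact ⟨t, h2⟩
  · rintro ⟨t, ht⟩
    have hd : (Nat.rfind fun t =>
        Part.some (decide (∀ s, P (Nat.pair n t) s = false))).Dom := by
      refine Nat.rfind_dom'.2 ⟨t, ?_, fun _ => trivial⟩
      rw [Part.mem_some_iff, eq_comm, decide_eq_true_eq, hstable]
      exact ⟨m, ht t le_rfl, ht⟩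
    obtain ⟨t', ht'⟩ := Part.dom_iff_mem.1 hd
    have h1 := Nat.rfind_spec ht'
    rw [Part.mem_some_iff, eq_comm, decide_eq_true_eq, hstable] at h1
    obtain ⟨m', h1, h2⟩ := h1
    have hmm : m' = m := by
      have := (h2 _ (le_max_left t' t)).symm.trans (ht _ (le_max_right t' t))
      simpa using this
    refine ⟨Nat.pair n t', ⟨_, ⟨_, rfl, rfl⟩, t', ht', rfl⟩, ?_⟩
    simp [h1, hmm]

/-- A partial function which is the limit of a computable sequence, being defined exactly where
the limit exists, is computable in the halting problem. -/
theorem recursiveIn_of_eventually {α : Type*} [Primcodable α] {g : α → ℕ → Option ℕ}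
    (hg : Computable₂ g) {h : α →. ℕ}
    (hh : ∀ a m, m ∈ h a ↔ ∀ᶠ s in atTop, g a s = some m) :
    RecursiveIn {haltingOracle} h := by
  refine nat_recursiveIn_of_eventually
    (g := fun n s => (decode (α := α) n).bind fun a => g a s) ?_ fun n m => ?_
  · exact Computable.option_bind (Computable.decode.comp Computable.fst)
      (hg.comp Computable.snd (Computable.snd.comp Computable.fst))
  · cases hn : decode (α := α) n with
    | none => simpa using fun x => ⟨x, le_rfl⟩
    | some a => simp [hh]

variable {D : Type*}

/-! ### Total approximations of maxima and minima -/

theorem finite_setOf_mem_part (x : Part D) : {d | d ∈ x}.Finite :=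
  Set.Subsingleton.finite fun _ ha _ hb => Part.mem_unique ha hb

/-- The value of `h` at the greatest argument below `n` at which it is defined. -/
def lastValue (h : ℕ → Option ℕ) : ℕ → Option ℕ :=
  fun n => Nat.rec none (fun t acc => (h t).or acc) n

theorem lastValue_succ (h : ℕ → Option ℕ) (n : ℕ) :
    lastValue h (n + 1) = (h n).or (lastValue h n) := rfl

theorem exists_of_lastValue_eq_some {h : ℕ → Option ℕ} {n m : ℕ} (hm : lastValue h n = some m) :
    ∃ t < n, h t = some m ∧ ∀ t' < n, (h t').isSome → t' ≤ t := by
  induction n with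
  | zero => simp [lastValue] at hm
  | succ n ih =>
    rw [lastValue_succ] at hm
    cases hn : h n with
    | some a =>
      rw [hn] at hm
      exact ⟨n, n.lt_succ_self, by simpa [hn] using hm, fun t' ht' _ => Nat.lt_succ_iff.1 ht'⟩
    | none =>
      rw [hn] at hm
      obtain ⟨t, ht, h1, h2⟩ := ih (by simpa using hm)
      refine ⟨t, ht.trans n.lt_succ_self, h1, fun t' ht' hs => ?_⟩
      rcases Nat.lt_succ_iff_lt_or_eq.1 ht' with h3 | rfl
      · exact h2 t' h3 hs
      · simp [hn] at hs

theorem isSome_lastValue {h : ℕ → Option ℕ} {n t : ℕ} (ht : t < n) (hs : (h t).isSome) :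
    (lastValue h n).isSome := by
  induction n with
  | zero => omega
  | succ n ih =>
    rw [lastValue_succ]
    rcases Nat.lt_succ_iff_lt_or_eq.1 ht with h3 | rfl
    · simp [ih h3]
    · simp [hs]

/-- Numbers of values of `F`, approximated by a primitive recursive sequence which converges
exactly at the arguments where `F` is defined, does not come back to a value it has left, and
is bounded by `F` in the sense of the relation `r`. -/
structure IsApproximation (ρ : ℕ ≃ D) (r : D → D → Prop) (F : List Bool →. D)
    (u : List Bool → ℕ → Option ℕ) : Prop where
  primrec : Primrec₂ u
  mem_iff : ∀ p m, ρ m ∈ F p ↔ ∀ᶠ s in atTop, u p s = some m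
  converges : ∀ p m, (∀ᶠ s in atTop, u p s = some m) ∨ ∀ᶠ s in atTop, u p s ≠ some m
  rel : ∀ p d s m, d ∈ F p → u p s = some m → r (ρ m) d

/-- A partial computable function, evaluated for a bounded number of steps. -/
theorem exists_primrec_stages {ρ : ℕ ≃ D} {f : List Bool × ℕ →. D} (hf : PartrecInto ρ f) :
    ∃ e : List Bool → ℕ → ℕ → Option ℕ,
      (Primrec fun x : (List Bool × ℕ) × ℕ => e x.1.1 x.1.2 x.2) ∧
      (∀ {p t m}, ρ m ∈ f (p, t) ↔ ∃ s, e p s t = some m) ∧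
      ∀ {p s s' t m}, s ≤ s' → e p s t = some m → e p s' t = some m := by
  obtain ⟨c, hc⟩ := Code.exists_code.1 hf
  refine ⟨fun p s t => Code.evaln s c (encode (p, t)), ?_, ?_, fun h h' => Code.evaln_mono h h'⟩
  · exact Code.primrec_evaln.comp (Primrec.pair (Primrec.pair
      (Primrec.snd.comp Primrec.fst) (Primrec.const c)) (Primrec.encode.comp
        (Primrec.pair (Primrec.fst.comp Primrec.fst) Primrec.snd)))
  · intro p t m
    have h1 : (∃ s, Code.evaln s c (encode (p, t)) = some m) ↔ m ∈ c.eval (encode (p, t)) :=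
      Code.evaln_complete.symm
    rw [h1, hc]
    simp only [encodek, Part.coe_some, Part.bind_some, Part.mem_map_iff, encode_nat]
    constructor
    · intro h
      exact ⟨m, ⟨_, h, by simp⟩, rfl⟩
    · rintro ⟨_, ⟨d, hd, rfl⟩, rfl⟩
      simpa using hd

/-- At stage `s`, take the value of `f` at the latest argument below `s` where it is seen to
converge within `s` steps. That argument never decreases with `s`, so monotonicity of `f` passes to
`u`. -/
theorem exists_isApproximation_of_isMaxOf [PartialOrder D] {ρ : ℕ ≃ D} {f : List Bool × ℕ →. D}
    {F : List Bool →. D} (hf : PartrecInto ρ f) (hF : IsMaxOf f F) :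
    ∃ u, IsApproximation ρ (· ≤ ·) F u := by
  obtain ⟨hmono, hdom, hgr⟩ := hF
  obtain ⟨e, heprim, he, hemono⟩ := exists_primrec_stages hf
  let u : List Bool → ℕ → Option ℕ := fun p s => lastValue (e p s) s
  have hprim : Primrec₂ u := by
    refine Primrec.nat_rec' (f := fun x : List Bool × ℕ => x.2)
      (g := fun _ => (none : Option ℕ))
      (h := fun x y => (e x.1 x.2 y.1).or y.2) Primrec.snd (Primrec.const _) ?_
    have h1 : Primrec fun x : (List Bool × ℕ) × (ℕ × Option ℕ) => e x.1.1 x.1.2 x.2.1 :=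
      heprim.comp (Primrec.pair Primrec.fst (Primrec.fst.comp Primrec.snd))
    refine (Primrec.option_orElse.comp h1 (Primrec.snd.comp Primrec.snd)).of_eq fun x => ?_
    simp
  have hlast : ∀ {p s m}, u p s = some m → ∃ t < s, e p s t = some m ∧
      ∀ t' < s, (e p s t').isSome → t' ≤ t := fun h => exists_of_lastValue_eq_some h
  have hvalue : ∀ {p s m}, u p s = some m → ρ m ∈ valuesAt f p := by
    intro p s m h
    obtain ⟨t, -, ht, -⟩ := hlast h
    exact ⟨t, he.2 ⟨s, ht⟩⟩
  have humono : ∀ {p s s' a b}, s ≤ s' → u p s = some a → u p s' = some b → ρ a ≤ ρ b := by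
    intro p s s' a b hs ha hb
    obtain ⟨t, hts, ht, -⟩ := hlast ha
    obtain ⟨t', -, ht', hmax⟩ := hlast hb
    exact hmono p t t' _ _ (hmax t (hts.trans_le hs) (by simp [hemono hs ht]))
      (he.2 ⟨s, ht⟩) (he.2 ⟨s', ht'⟩)
  have husome : ∀ {p s s' a}, s ≤ s' → u p s = some a → ∃ b, u p s' = some b := by
    intro p s s' a hs ha
    obtain ⟨t, hts, ht, -⟩ := hlast ha
    exact Option.isSome_iff_exists.1
      (isSome_lastValue (hts.trans_le hs) (by simp [hemono hs ht]))
  have hlater : ∀ {p t d}, d ∈ f (p, t) → ∀ᶠ s in atTop, ∃ t' ≥ t, ∃ b,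
      u p s = some b ∧ ρ b ∈ f (p, t') := by
    intro p t d hd
    obtain ⟨m, rfl⟩ := ρ.surjective d
    obtain ⟨s, hs⟩ := he.1 hd
    filter_upwards [eventually_ge_atTop (max s (t + 1))] with s' hs'
    have h1 : e p s' t = some m := hemono (le_of_max_le_left hs') hs
    have h2 : t < s' := le_of_max_le_right hs'
    obtain ⟨b, hb⟩ := Option.isSome_iff_exists.1
      (isSome_lastValue (h := e p s') h2 (by simp [h1]))
    obtain ⟨t', -, ht', hmax⟩ := hlast hb
    exact ⟨t', hmax t h2 (by simp [h1]), b, hb, he.2 ⟨s', ht'⟩⟩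
  refine ⟨u, hprim, fun p m => ⟨fun h => ?_, fun h => ?_⟩, fun p m => ?_,
    fun p d s m hd hs => (hgr p d hd).2 (hvalue hs)⟩
  · obtain ⟨⟨t, ht⟩, hub⟩ := hgr p _ h
    filter_upwards [hlater ht] with s hs
    obtain ⟨t', htt', b, hb, hbf⟩ := hs
    rw [hb, ρ.injective (le_antisymm (hub ⟨t', hbf⟩) (hmono p t t' _ _ htt' ht hbf))]
  -- A limit bounds all values of `f`. From an argument `t₀` where it occurs `f` takes no other
  -- value, and only finitely many arguments precede `t₀`, so the range is finite.
  · have hub : ∀ d ∈ valuesAt f p, d ≤ ρ m := by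
      rintro d ⟨t, ht⟩
      obtain ⟨s, ⟨t', htt', b, hb, hbf⟩, hs⟩ := ((hlater ht).and h).exists
      rw [hb] at hs
      cases hs
      exact hmono p t t' _ _ htt' ht hbf
    obtain ⟨s, hs⟩ := h.exists
    obtain ⟨t₀, ht₀⟩ := hvalue hs
    have hfin : (valuesAt f p).Finite := by
      have hfin' : (⋃ t ∈ Set.Iio t₀, {d | d ∈ f (p, t)}).Finite :=
        (Set.finite_Iio t₀).biUnion fun t _ => finite_setOf_mem_part _
      refine (hfin'.union (Set.finite_singleton (ρ m))).subset ?_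
      rintro d ⟨t, ht⟩
      rcases lt_or_ge t t₀ with h1 | h1
      · exact Or.inl (Set.mem_biUnion (Set.mem_Iio.2 h1) ht)
      · exact Or.inr (le_antisymm (hub d ⟨t, ht⟩) (hmono p t₀ t _ _ h1 ht₀ ht))
    obtain ⟨d, hd⟩ := Part.dom_iff_mem.1 ((hdom p).2 ⟨hfin, _, t₀, ht₀⟩)
    rwa [← (hgr p d hd).unique ⟨⟨t₀, ht₀⟩, hub⟩]
  -- A value that recurs is squeezed between its own occurrences, hence is constant from its first
  -- one on.
  · by_cases h : ∃ᶠ s in atTop, u p s = some m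
    · left
      obtain ⟨s₀, hs₀⟩ := h.exists
      filter_upwards [eventually_ge_atTop s₀] with s hs
      obtain ⟨s₁, hs₁, h1⟩ := frequently_atTop.1 h s
      obtain ⟨b, hb⟩ := husome hs hs₀
      rw [hb, ρ.injective (le_antisymm (humono hs₁ hb h1) (humono hs hs₀ hb))]
    · exact Or.inr (not_frequently.1 h)

theorem exists_isApproximation_of_mem_classMaxPR [PartialOrder D] {ρ : ℕ ≃ D}
    {F : List Bool →. D} (hF : F ∈ classMaxPR ρ) : ∃ u, IsApproximation ρ (· ≤ ·) F u :=
  let ⟨_, hf, hF⟩ := hF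
  exists_isApproximation_of_isMaxOf hf hF

theorem exists_isApproximation_of_mem_classMinPR [PartialOrder D] {ρ : ℕ ≃ D}
    {F : List Bool →. D} (hF : F ∈ classMinPR ρ) : ∃ u, IsApproximation ρ (· ≥ ·) F u :=
  let ⟨f, hf, hF⟩ := hF
  let ⟨u, hu⟩ := exists_isApproximation_of_isMaxOf (D := Dᵒᵈ) (ρ := ρ) (f := f) (F := F) hf hF
  ⟨u, hu.primrec, hu.mem_iff, hu.converges, hu.rel⟩

theorem IsApproximation.mem_classJumpPR {ρ : ℕ ≃ D} {r : D → D → Prop} {F : List Bool →. D}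
    {u : List Bool → ℕ → Option ℕ} (hu : IsApproximation ρ r F u) : F ∈ classJumpPR ρ := by
  refine recursiveIn_of_eventually hu.primrec.to_comp fun p m => ?_
  rw [← hu.mem_iff, Part.mem_map_iff]
  constructor
  · rintro ⟨d, hd, rfl⟩
    simpa using hd
  · exact fun h => ⟨_, h, by simp⟩

/-! ### Words of bounded length -/

/-- The words of length at most `n`. -/
def wordsUpTo (n : ℕ) : List (List Bool) :=
  Nat.rec [[]] (fun _ l => [] :: l.flatMap fun q => [false :: q, true :: q]) n

theorem mem_wordsUpTo {n : ℕ} {q : List Bool} (hq : q.length ≤ n) : q ∈ wordsUpTo n := by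
  induction n generalizing q with
  | zero => simpa [wordsUpTo] using hq
  | succ n ih =>
    cases q with
    | nil => exact List.mem_cons_self
    | cons b q =>
      refine List.mem_cons_of_mem _ (List.mem_flatMap.2
        ⟨q, ih (Nat.succ_le_succ_iff.1 hq), ?_⟩)
      cases b <;> simp

theorem primrec_wordsUpTo : Primrec wordsUpTo := by
  refine Primrec.nat_rec₁ (f := fun _ l => [] :: l.flatMap fun q => [false :: q, true :: q])
    _ ?_
  refine Primrec.list_cons.comp (Primrec.const _) (Primrec.list_flatMap Primrec.snd ?_)
  have h : ∀ b : Bool, Primrec fun x : (ℕ × List (List Bool)) × List Bool => b :: x.2 :=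
    fun b => Primrec.list_cons.comp (Primrec.const b) Primrec.snd
  exact Primrec.list_cons.comp (h false) (Primrec.list_cons.comp (h true) (Primrec.const _))

/-! ### Diagonalization -/

/-- The value at `p` is the least number not excluded by the finitely many short words. It is a
limit of computable guesses because each exclusion settles, even where the approximations themselves
diverge. -/
theorem exists_mem_classJumpPR_avoiding {ρ : ℕ ≃ D} {r r' : D → D → Prop} {U V : List Bool →. D}
    {u v : List Bool → ℕ → Option ℕ} (hu : IsApproximation ρ r U u)
    (hv : IsApproximation ρ r' V v) :
    ∃ ψ ∈ classJumpPR ρ, ∀ p, ∃ d ∈ ψ p, ∀ q : List Bool, q.length ≤ 2 * p.length →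
      d ∉ U q ∧ d ∉ V q := by
  classical
  let W : List Bool → List (List Bool) := fun p => wordsUpTo (2 * p.length)
  let P : List Bool → ℕ → ℕ → Prop := fun p s m =>
    ∀ q ∈ W p, ¬ (u q s = some m ∨ v q s = some m)
  let Q : List Bool → ℕ → Prop := fun p m => ∀ q ∈ W p, ¬ (ρ m ∈ U q ∨ ρ m ∈ V q)
  have hlim : ∀ p m, ∀ᶠ s in atTop, (P p s m ↔ Q p m) := by
    intro p m
    have h1 : ∀ q ∈ (W p).toFinset, ∀ᶠ s in atTop,
        (u q s = some m ∨ v q s = some m ↔ ρ m ∈ U q ∨ ρ m ∈ V q) := by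
      intro q _
      have key : ∀ {F : List Bool →. D} {r : D → D → Prop} {w : List Bool → ℕ → Option ℕ},
          IsApproximation ρ r F w → ∀ᶠ s in atTop, (w q s = some m ↔ ρ m ∈ F q) := by
        intro F r w hw
        rcases hw.converges q m with h | h
        · have := (hw.mem_iff q m).2 h
          filter_upwards [h] with s hs
          simp [hs, this]
        · have : ρ m ∉ F q := fun hF => by
            obtain ⟨s, h1, h2⟩ := (h.and ((hw.mem_iff q m).1 hF)).exists
            exact h1 h2
          filter_upwards [h] with s hs
          simp [hs, this]
      filter_upwards [key hu, key hv] with s hs hs'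
      rw [hs, hs']
    filter_upwards [(Filter.eventually_all_finset _).2 h1] with s hs
    exact forall₂_congr fun q hq => not_congr (hs q (by simpa using hq))
  -- `D` is infinite, being numbered bijectively, and finitely many words have finitely many values.
  have hex : ∀ p, ∃ m, Q p m := by
    intro p
    have hfin : {d : D | ∃ q ∈ W p, d ∈ U q ∨ d ∈ V q}.Finite := by
      have : {d : D | ∃ q ∈ W p, d ∈ U q ∨ d ∈ V q} =
          ⋃ q ∈ {q | q ∈ W p}, ({d | d ∈ U q} ∪ {d | d ∈ V q}) := by
        ext d; simp
      rw [this]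
      exact (List.finite_toSet (W p)).biUnion fun q _ =>
        (finite_setOf_mem_part _).union (finite_setOf_mem_part _)
    obtain ⟨m, hm⟩ := (hfin.preimage ρ.injective.injOn).infinite_compl.nonempty
    exact ⟨m, fun q hq h => hm ⟨q, hq, h⟩⟩
  let g : List Bool → ℕ → Option ℕ := fun p s =>
    ((List.range s).filterMap fun m => if P p s m then some m else none).head?
  have hgfind : ∀ p s, g p s = (List.range s).find? fun m => decide (P p s m) := by
    intro p s
    rw [← List.head?_filter, ← List.filterMap_eq_filter]
    simp only [g, Option.guard, decide_eq_true_eq]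
  have hW : Primrec W :=
    primrec_wordsUpTo.comp (Primrec.nat_mul.comp (Primrec.const 2) Primrec.list_length)
  have hPrel : PrimrecRel fun (q : List Bool) (x : (List Bool × ℕ) × ℕ) =>
      ¬ (u q x.1.2 = some x.2 ∨ v q x.1.2 = some x.2) := by
    have hq : Primrec fun y : List Bool × ((List Bool × ℕ) × ℕ) => y.1 := Primrec.fst
    have hs : Primrec fun y : List Bool × ((List Bool × ℕ) × ℕ) => y.2.1.2 :=
      Primrec.snd.comp (Primrec.fst.comp Primrec.snd)
    have hm : Primrec fun y : List Bool × ((List Bool × ℕ) × ℕ) => some y.2.2 :=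
      Primrec.option_some.comp (Primrec.snd.comp Primrec.snd)
    exact PrimrecPred.not (PrimrecPred.or (Primrec.eq.comp (hu.primrec.comp hq hs) hm)
      (Primrec.eq.comp (hv.primrec.comp hq hs) hm))
  have hPpred : PrimrecPred fun x : (List Bool × ℕ) × ℕ => P x.1.1 x.1.2 x.2 :=
    (PrimrecRel.forall_mem_list hPrel).comp
      (hW.comp (Primrec.fst.comp Primrec.fst)) Primrec.id
  have hg : Primrec₂ g := by
    refine Primrec.list_head?.comp (Primrec.listFilterMap
      (Primrec.list_range.comp Primrec.snd) ?_)
    exact Primrec.ite hPpred (Primrec.option_some.comp Primrec.snd) (Primrec.const none)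
  -- The guess is right once the conditions on all numbers up to the least solution have settled.
  have hgl : ∀ p, ∀ᶠ s in atTop, g p s = some (Nat.find (hex p)) := by
    intro p
    have h1 : ∀ᶠ s in atTop, ∀ m ∈ Finset.range (Nat.find (hex p) + 1), (P p s m ↔ Q p m) :=
      (Filter.eventually_all_finset _).2 fun m _ => hlim p m
    filter_upwards [h1, eventually_gt_atTop (Nat.find (hex p))] with s hs hs'
    rw [hgfind, List.find?_range_eq_some]
    refine ⟨?_, List.mem_range.2 hs', fun m hm => ?_⟩
    · simpa [hs] using Nat.find_spec (hex p)
    · have := Nat.find_min (hex p) hm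
      rw [← hs m (Finset.mem_range.2 (hm.trans (Nat.lt_succ_self _)))] at this
      simpa using this
  refine ⟨fun p => Part.some (ρ (Nat.find (hex p))), ?_, fun p =>
    ⟨_, Part.mem_some _, fun q hq => ?_⟩⟩
  · refine recursiveIn_of_eventually hg.to_comp fun p m => ?_
    simp only [Part.map_some, Equiv.symm_apply_apply, Part.mem_some_iff]
    constructor
    · rintro rfl
      exact hgl p
    · intro h
      obtain ⟨s, h1, h2⟩ := (h.and (hgl p)).exists
      rw [h1] at h2
      simpa using h2
  · exact not_or.1 (Nat.find_spec (hex p) q (mem_wordsUpTo hq))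

/-! ### A pairing of words of small length -/

/-- The binary digits of `n`, least significant first; a single `false` for `n = 0`. -/
def binaryDigits (n : ℕ) : List Bool :=
  (List.range (Nat.log 2 n + 1)).map fun i => decide (n / 2 ^ i % 2 = 1)

theorem length_binaryDigits (n : ℕ) : (binaryDigits n).length = Nat.log 2 n + 1 := by
  simp [binaryDigits]

theorem binaryDigits_injective : Function.Injective binaryDigits := by
  intro n m h
  have hlog : Nat.log 2 n = Nat.log 2 m := by
    have := congrArg List.length h
    simpa [length_binaryDigits] using this
  refine Nat.eq_of_testBit_eq fun i => ?_
  by_cases hi : i < Nat.log 2 n + 1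
  · have h1 := congrArg (fun l => l[i]?) h
    simp only [binaryDigits, ← hlog, List.getElem?_map, List.getElem?_range hi, Option.map_some,
      Option.some.injEq] at h1
    rw [Nat.testBit_eq_decide_div_mod_eq, Nat.testBit_eq_decide_div_mod_eq, h1]
  · have h2 : ∀ k, Nat.log 2 k = Nat.log 2 n → k.testBit i = false := fun k hk =>
      Nat.testBit_eq_false_of_lt ((Nat.lt_pow_succ_log_self one_lt_two k).trans_le
        (Nat.pow_le_pow_right two_pos (by omega)))
    rw [h2 n rfl, h2 m hlog.symm]

theorem primrec_log_two : Primrec (Nat.log 2) := by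
  have hpow : Primrec₂ fun a b : ℕ => a ^ b := Primrec₂.unpaired'.1 Nat.Primrec.pow
  have h : Primrec fun n : ℕ => Nat.findGreatest (fun k => 2 ^ k ≤ n) n :=
    Primrec.nat_findGreatest Primrec.id
      (Primrec.nat_le.comp (hpow.comp (Primrec.const 2) Primrec.snd) Primrec.fst)
  refine h.of_eq fun n => ?_
  rcases Nat.eq_zero_or_pos n with rfl | hn
  · simp
  · refine (Nat.findGreatest_eq_iff).2 ⟨(Nat.log_lt_self 2 hn.ne').le,
      fun _ => Nat.pow_log_le_self 2 hn.ne', fun k hk _ h => ?_⟩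
    exact absurd (Nat.le_log_of_pow_le one_lt_two h) (not_le.2 hk)

theorem primrec_binaryDigits : Primrec binaryDigits := by
  have hpow : Primrec₂ fun a b : ℕ => a ^ b := Primrec₂.unpaired'.1 Nat.Primrec.pow
  refine Primrec.list_map (Primrec.list_range.comp (Primrec.succ.comp primrec_log_two)) ?_
  refine PrimrecPred.decide (Primrec.eq.comp (Primrec.nat_mod.comp (Primrec.nat_div.comp
    Primrec.fst (hpow.comp (Primrec.const 2) Primrec.snd)) (Primrec.const 2)) (Primrec.const 1))

/-- A self-delimiting form of the word `l`. -/
def selfDelimited (l : List Bool) : List Bool :=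
  (l.flatMap fun b => [true, b]) ++ [false]

theorem length_selfDelimited (l : List Bool) : (selfDelimited l).length = 2 * l.length + 1 := by
  induction l with
  | nil => rfl
  | cons b l ih => simp [selfDelimited] at ih ⊢; omega

/-- The `true` before each digit and the closing `false` show where the coded word ends, whatever
follows it. -/
theorem selfDelimited_append_inj {l l' x y : List Bool}
    (h : selfDelimited l ++ x = selfDelimited l' ++ y) : l = l' ∧ x = y := by
  induction l generalizing l' with
  | nil => cases l' <;> simp_all [selfDelimited]
  | cons b l ih =>
    cases l' with
    | nil => simp [selfDelimited] at h
    | cons b' l' =>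
      simp only [selfDelimited, List.flatMap_cons, List.cons_append, List.nil_append,
        List.cons.injEq, true_and] at h
      obtain ⟨rfl, h⟩ := h
      obtain ⟨rfl, rfl⟩ := ih h
      exact ⟨rfl, rfl⟩

theorem primrec_selfDelimited : Primrec selfDelimited :=
  Primrec.list_append.comp (Primrec.list_flatMap Primrec.id (Primrec.list_cons.comp
    (Primrec.const true) (Primrec.list_cons.comp Primrec.snd (Primrec.const []))))
    (Primrec.const [false])

/-- The concatenation of `p` and `q`, preceded by a self-delimiting form of the length of `p`. -/
def delimitedAppend (p q : List Bool) : List Bool :=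
  selfDelimited (binaryDigits p.length) ++ (p ++ q)

theorem delimitedAppend_inj {p q p' q' : List Bool}
    (h : delimitedAppend p q = delimitedAppend p' q') : p = p' ∧ q = q' := by
  obtain ⟨h1, h2⟩ := selfDelimited_append_inj h
  exact List.append_inj h2 (binaryDigits_injective h1)

theorem length_delimitedAppend (p q : List Bool) :
    (delimitedAppend p q).length = p.length + q.length + 2 * Nat.log 2 p.length + 3 := by
  simp only [delimitedAppend, List.length_append, length_selfDelimited, length_binaryDigits]
  omega

theorem primrec_delimitedAppend : Primrec₂ delimitedAppend :=
  Primrec.list_append.comp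
    (primrec_selfDelimited.comp (primrec_binaryDigits.comp (Primrec.list_length.comp Primrec.fst)))
    (Primrec.list_append.comp Primrec.fst Primrec.snd)

/-- An injective pairing of words, whose overhead is twice the logarithm of the length of the
shorter word. -/
def wordPair (x : List Bool × List Bool) : List Bool :=
  if x.1.length ≤ x.2.length then true :: delimitedAppend x.1 x.2
  else false :: delimitedAppend x.2 x.1

theorem wordPair_injective : Function.Injective wordPair := by
  rintro ⟨p, q⟩ ⟨p', q'⟩ h
  unfold wordPair at h
  -- The leading bit records which word comes first, so the mixed cases are contradictory.
  split_ifs at h <;> simp only [List.cons.injEq, true_and, reduceCtorEq, false_and] at h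
  · obtain ⟨h1, h2⟩ := delimitedAppend_inj h
    exact Prod.ext h1 h2
  · obtain ⟨h1, h2⟩ := delimitedAppend_inj h
    exact Prod.ext h2 h1

theorem length_wordPair (p q : List Bool) : (wordPair (p, q)).length =
    p.length + q.length + 2 * Nat.log 2 (min p.length q.length) + 4 := by
  unfold wordPair
  split_ifs with h
  · simp only [List.length_cons, length_delimitedAppend, min_eq_left h]
  · simp only [List.length_cons, length_delimitedAppend, min_eq_right (not_le.1 h).le]
    omega

theorem primrec_wordPair : Primrec wordPair :=
  Primrec.ite (Primrec.nat_le.comp (Primrec.list_length.comp Primrec.fst)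
      (Primrec.list_length.comp Primrec.snd))
    (Primrec.list_cons.comp (Primrec.const true) primrec_delimitedAppend)
    (Primrec.list_cons.comp (Primrec.const false)
      (primrec_delimitedAppend.comp Primrec.snd Primrec.fst))

/-! ### Complexity -/

theorem complexity_le {F : List Bool →. D} {d : D} {p : List Bool} (h : d ∈ F p) :
    complexity F d ≤ p.length :=
  Nat.sInf_le ⟨p, h, rfl⟩

theorem exists_length_eq_complexity {F : List Bool →. D} {d : D} (h : d ∈ F.ran) :
    ∃ p, d ∈ F p ∧ p.length = complexity F d :=
  let ⟨p, hp⟩ := h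
  Nat.sInf_mem (s := {n | ∃ p, d ∈ F p ∧ p.length = n}) ⟨_, p, hp, rfl⟩

theorem IsOptimal.leCt {C : Set (List Bool →. D)} {φ ψ : List Bool →. D} (hφ : IsOptimal C φ)
    (hψ : ψ ∈ C) (hran : ∀ d, d ∈ ψ.ran) : LeCt (complexity φ) (complexity ψ) :=
  let ⟨c, hc⟩ := hφ.2 ψ hψ
  ⟨c, fun d => (hc d (hran d)).2⟩

/-- Full range ensures that `complexity` is attained by a program and is not the default `0`. -/
theorem IsOptimal.mem_ran {C : Set (List Bool →. D)} {φ : List Bool →. D} (hφ : IsOptimal C φ)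
    (hC : ∀ d : D, (fun _ => Part.some d) ∈ C) (d : D) : d ∈ φ.ran :=
  let ⟨_, hc⟩ := hφ.2 _ (hC d)
  (hc d ⟨[], Part.mem_some d⟩).1

theorem const_mem_classPR (ρ : ℕ ≃ D) (d : D) : (fun _ => Part.some d) ∈ classPR ρ := by
  refine (Partrec.some.comp (Computable.const (ρ.symm d)) : Partrec fun _ : List Bool => _).of_eq
    fun p => ?_
  simp

/-! ### Inequalities between the complexities. -/

section PartialOrder

variable [PartialOrder D] {ρ : ℕ ≃ D}

theorem classPR_subset_classMaxPR : classPR ρ ⊆ classMaxPR ρ := by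
  intro F hF
  have hv : ∀ p, valuesAt (fun x : List Bool × ℕ => F x.1) p = {d | d ∈ F p} := by
    intro p; ext d; simp [valuesAt]
  have hF' : Partrec fun x : List Bool × ℕ => (F x.1).map ρ.symm :=
    Partrec.comp (f := fun p => (F p).map ρ.symm) hF Computable.fst
  refine ⟨fun x => F x.1, hF', ?_, fun p => ?_, fun p d hd => ?_⟩
  · intro p s t a b _ ha hb
    exact (Part.mem_unique ha hb).le
  · rw [hv, Part.dom_iff_mem]
    exact ⟨fun h => ⟨finite_setOf_mem_part _, h⟩,
      fun h => h.2⟩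
  · rw [hv]
    exact ⟨hd, fun e he => (Part.mem_unique he hd).le⟩

theorem classPR_subset_classMinPR : classPR ρ ⊆ classMinPR ρ :=
  classPR_subset_classMaxPR (D := Dᵒᵈ)

/-- A word `c (p, q)`, where `p` describes `d` as a minimum and `q` as a maximum, describes `d`
with respect to a suitable partial computable function. -/
theorem exists_mem_classPR_of_pairing {U V : List Bool →. D} {u v : List Bool → ℕ → Option ℕ}
    (hu : IsApproximation ρ (· ≤ ·) U u) (hv : IsApproximation ρ (· ≥ ·) V v)
    {c : List Bool × List Bool → List Bool} (hc : Computable c) (hinj : Function.Injective c) :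
    ∃ ψ ∈ classPR ρ, ∀ p q d, d ∈ V p → d ∈ U q → d ∈ ψ (c (p, q)) := by
  -- One test of the search on input `r`: a candidate pair coded by `r`, and a stage at which its
  -- two approximations agree.
  let S : List Bool → (List Bool × List Bool) × ℕ → Option ℕ := fun r x =>
    bif decide (c x.1 = r) && decide (u x.1.2 x.2 = v x.1.1 x.2) then u x.1.2 x.2 else none
  have hS : Computable₂ S := by
    have hx : Computable fun y : List Bool × ((List Bool × List Bool) × ℕ) => y.2.1 :=
      Computable.fst.comp Computable.snd
    have hs : Computable fun y : List Bool × ((List Bool × List Bool) × ℕ) => y.2.2 :=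
      Computable.snd.comp Computable.snd
    have hu' : Computable fun y : List Bool × ((List Bool × List Bool) × ℕ) =>
        u y.2.1.2 y.2.2 := hu.primrec.to_comp.comp (Computable.snd.comp hx) hs
    have hv' : Computable fun y : List Bool × ((List Bool × List Bool) × ℕ) =>
        v y.2.1.1 y.2.2 := hv.primrec.to_comp.comp (Computable.fst.comp hx) hs
    have heq : Computable₂ fun a b : Option ℕ => decide (a = b) :=
      (PrimrecRel.decide Primrec.eq).to_comp
    have heq' : Computable₂ fun a b : List Bool => decide (a = b) :=
      (PrimrecRel.decide Primrec.eq).to_comp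
    exact Computable.cond (Primrec.and.to_comp.comp (heq'.comp (hc.comp hx) Computable.fst)
      (heq.comp hu' hv')) hu' (Computable.const none)
  have hSmem : ∀ {r x m}, S r x = some m ↔
      c x.1 = r ∧ u x.1.2 x.2 = some m ∧ v x.1.1 x.2 = some m := by
    intro r x m
    simp only [S, Bool.cond_eq_ite, Bool.and_eq_true, decide_eq_true_eq]
    split_ifs with h
    · exact ⟨fun h' => ⟨h.1, h', h.2 ▸ h'⟩, fun h' => h'.2.1⟩
    · exact ⟨fun h' => by simp at h', fun h' => absurd ⟨h'.1, h'.2.1.trans h'.2.2.symm⟩ h⟩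
  let T : List Bool → ℕ → Option ℕ := fun r n => (decode n).bind (S r)
  have hT : Computable₂ T :=
    Computable.option_bind (Computable.decode.comp Computable.snd)
      (hS.comp (Computable.fst.comp Computable.fst) Computable.snd)
  refine ⟨fun r => (Nat.rfindOpt (T r)).map ρ, ?_, fun p q d hp hq => ?_⟩
  · refine (Partrec.rfindOpt hT).of_eq fun r => ?_
    rw [Part.map_map, Equiv.symm_comp_self]
    exact (Part.map_id' (fun _ => rfl) _).symm
  · obtain ⟨m, rfl⟩ := ρ.surjective d
    obtain ⟨s, hus, hvs⟩ := (((hu.mem_iff q m).1 hq).and ((hv.mem_iff p m).1 hp)).exists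
    have hdom : (Nat.rfindOpt (T (c (p, q)))).Dom :=
      Nat.rfindOpt_dom.2 ⟨encode ((p, q), s), m, by
        simp only [T, encodek, Option.bind_some]
        exact hSmem.2 ⟨rfl, hus, hvs⟩⟩
    obtain ⟨m', hm'⟩ := Part.dom_iff_mem.1 hdom
    refine (Part.mem_map_iff _).2 ⟨m', hm', ?_⟩
    obtain ⟨n, hn⟩ := Nat.rfindOpt_spec hm'
    obtain ⟨⟨⟨p', q'⟩, s'⟩, -, hx⟩ := Option.bind_eq_some_iff.1 hn
    obtain ⟨h1, h2, h3⟩ := hSmem.1 hx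
    -- Injectivity makes the pair found the intended one. The common value then lies both below and
    -- above `d`.
    cases hinj h1
    exact le_antisymm (hu.rel _ _ _ _ hq h2) (hv.rel _ _ _ _ hp h3)

theorem leCt_complexity_of_pairing {φ U V : List Bool →. D} (hφ : IsOptimal (classPR ρ) φ)
    (hU : IsOptimal (classMaxPR ρ) U) (hV : IsOptimal (classMinPR ρ) V)
    {c : List Bool × List Bool → List Bool} {J : ℕ → ℕ → ℕ} {M : ℕ} (hc : Computable c)
    (hinj : Function.Injective c)
    (hJ : ∀ p q : List Bool, (c (p, q)).length ≤ J p.length q.length + M) :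
    LeCt (complexity φ) (fun d => J (complexity V d) (complexity U d)) := by
  obtain ⟨u, hu⟩ := exists_isApproximation_of_mem_classMaxPR hU.1
  obtain ⟨v, hv⟩ := exists_isApproximation_of_mem_classMinPR hV.1
  obtain ⟨ψ, hψ, h⟩ := exists_mem_classPR_of_pairing hu hv hc hinj
  obtain ⟨k, hk⟩ := hφ.2 ψ hψ
  refine ⟨M + k, fun d => ?_⟩
  obtain ⟨q, hq, hql⟩ := exists_length_eq_complexity
    (hU.mem_ran (fun d => classPR_subset_classMaxPR (const_mem_classPR ρ d)) d)
  obtain ⟨p, hp, hpl⟩ := exists_length_eq_complexity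
    (hV.mem_ran (fun d => classPR_subset_classMinPR (const_mem_classPR ρ d)) d)
  have h1 := h p q d hp hq
  have h2 := (hk d ⟨_, h1⟩).2
  have h3 := complexity_le h1
  have h4 := hJ p q
  rw [hql, hpl] at h4
  show complexity φ d ≤ J (complexity V d) (complexity U d) + (M + k)
  omega

theorem leCt_complexity_jump {φJ U V : List Bool →. D} (hφJ : IsOptimal (classJumpPR ρ) φJ)
    (hU : IsOptimal (classMaxPR ρ) U) (hV : IsOptimal (classMinPR ρ) V) :
    LeCt (complexity φJ) (fun d => min (complexity U d) (complexity V d)) := by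
  obtain ⟨u, hu⟩ := exists_isApproximation_of_mem_classMaxPR hU.1
  obtain ⟨v, hv⟩ := exists_isApproximation_of_mem_classMinPR hV.1
  obtain ⟨a, ha⟩ := hφJ.leCt hu.mem_classJumpPR
    (hU.mem_ran fun d => classPR_subset_classMaxPR (const_mem_classPR ρ d))
  obtain ⟨b, hb⟩ := hφJ.leCt hv.mem_classJumpPR
    (hV.mem_ran fun d => classPR_subset_classMinPR (const_mem_classPR ρ d))
  refine ⟨max a b, fun d => ?_⟩
  have := ha d
  have := hb d
  show complexity φJ d ≤ min (complexity U d) (complexity V d) + max a b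
  omega

theorem not_leCt_complexity_jump {φJ U V : List Bool →. D} (hφJ : IsOptimal (classJumpPR ρ) φJ)
    (hU : IsOptimal (classMaxPR ρ) U) (hV : IsOptimal (classMinPR ρ) V) :
    ¬ LeCt (fun d => min (complexity U d) (complexity V d)) (complexity φJ) := by
  rintro ⟨a, ha⟩
  obtain ⟨u, hu⟩ := exists_isApproximation_of_mem_classMaxPR hU.1
  obtain ⟨v, hv⟩ := exists_isApproximation_of_mem_classMinPR hV.1
  obtain ⟨ψ, hψ, h⟩ := exists_mem_classJumpPR_avoiding hu hv
  obtain ⟨b, hb⟩ := hφJ.2 ψ hψ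
  -- With this length `n = a + b + 1`, the assumed bound gives a minimum of at most `n + b + a < 2 *
  -- n`, but avoidance makes it exceed `2 * n`.
  obtain ⟨d, hd, hq⟩ := h (List.replicate (a + b + 1) true)
  have h1 := (hb d ⟨_, hd⟩).2
  have h2 := complexity_le hd
  have h3 : min (complexity U d) (complexity V d) ≤ complexity φJ d + a := ha d
  obtain ⟨p, hp, hpl⟩ := exists_length_eq_complexity
    (hU.mem_ran (fun d => classPR_subset_classMaxPR (const_mem_classPR ρ d)) d)
  obtain ⟨q, hq', hql⟩ := exists_length_eq_complexity
    (hV.mem_ran (fun d => classPR_subset_classMinPR (const_mem_classPR ρ d)) d)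
  rw [List.length_replicate] at h2 hq
  have h4 : 2 * (a + b + 1) < complexity U d := by
    by_contra hlt
    exact (hq p (by omega)).1 hp
  have h5 : 2 * (a + b + 1) < complexity V d := by
    by_contra hlt
    exact (hq q (by omega)).2 hq'
  omega

theorem leCt_complexity_add_logb {φ U V : List Bool →. D} (hφ : IsOptimal (classPR ρ) φ)
    (hU : IsOptimal (classMaxPR ρ) U) (hV : IsOptimal (classMinPR ρ) V) :
    LeCt (fun d => (complexity φ d : ℝ))
      (fun d => ((complexity U d : ℝ) + Real.logb 2 (complexity U d)) +
        ((complexity V d : ℝ) + Real.logb 2 (complexity V d))) := by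
  obtain ⟨k, hk⟩ := leCt_complexity_of_pairing hφ hU hV
    (J := fun a b => a + b + 2 * Nat.log 2 (min a b)) (M := 4)
    primrec_wordPair.to_comp wordPair_injective fun p q => (length_wordPair p q).le
  refine ⟨k, fun d => ?_⟩
  have h1 : complexity φ d ≤ complexity V d + complexity U d +
      2 * Nat.log 2 (min (complexity V d) (complexity U d)) + k := hk d
  -- Twice the logarithm of the minimum is at most the sum of the two logarithms, so each complexity
  -- is charged only one.
  have hlogV := Nat.log_mono_right (b := 2) (min_le_left (complexity V d) (complexity U d))
  have hlogU := Nat.log_mono_right (b := 2) (min_le_right (complexity V d) (complexity U d))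
  have h2 : complexity φ d ≤ complexity U d + Nat.log 2 (complexity U d) +
      (complexity V d + Nat.log 2 (complexity V d)) + k := by omega
  have h3 : (complexity φ d : ℝ) ≤ complexity U d + Nat.log 2 (complexity U d) +
      (complexity V d + Nat.log 2 (complexity V d)) + k := by exact_mod_cast h2
  have h4 : (Nat.log 2 (complexity U d) : ℝ) ≤ Real.logb 2 (complexity U d) := by
    exact_mod_cast Real.natLog_le_logb (complexity U d) 2
  have h5 : (Nat.log 2 (complexity V d) : ℝ) ≤ Real.logb 2 (complexity V d) := by
    exact_mod_cast Real.natLog_le_logb (complexity V d) 2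
  show (complexity φ d : ℝ) ≤ (complexity U d + Real.logb 2 (complexity U d)) +
    (complexity V d + Real.logb 2 (complexity V d)) + k
  linarith

end PartialOrder

end KolmogorovPoset

theorem theorem4p1 {D : Type*} [PartialOrder D] (ρ : ℕ ≃ D) (hD : IsComputablePoset ρ)
    (φ φJ U V : List Bool →. D)
    (hφ : IsOptimal (classPR ρ) φ) (hφJ : IsOptimal (classJumpPR ρ) φJ)
    (hU : IsOptimal (classMaxPR ρ) U) (hV : IsOptimal (classMinPR ρ) V) :
    LtCt (complexity φJ) (fun d => min (complexity U d) (complexity V d)) ∧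
    LeCt (complexity U) (complexity φ) ∧
    LeCt (complexity V) (complexity φ) ∧
    LeCt (fun d => (complexity φ d : ℝ))
      (fun d => ((complexity U d : ℝ) + Real.logb 2 (complexity U d)) +
        ((complexity V d : ℝ) + Real.logb 2 (complexity V d))) ∧
    (∀ (c : List Bool × List Bool → List Bool) (J : ℕ → ℕ → ℕ) (M : ℕ),
      Computable c → Function.Injective c →
      (∀ p q : List Bool, (c (p, q)).length ≤ J p.length q.length + M) →
      LeCt (complexity φ) (fun d => J (complexity V d) (complexity U d))) := by
  have hran : ∀ d, d ∈ φ.ran := hφ.mem_ran (const_mem_classPR ρ)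
  exact ⟨⟨leCt_complexity_jump hφJ hU hV, not_leCt_complexity_jump hφJ hU hV⟩,
    hU.leCt (classPR_subset_classMaxPR hφ.1) hran, hV.leCt (classPR_subset_classMinPR hφ.1) hran,
    leCt_complexity_add_logb hφ hU hV,
    fun _ _ _ hc hinj hJ => leCt_complexity_of_pairing hφ hU hV hc hinj hJ⟩
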